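/- Let $X=\{0,1\}^{\mathbb N}$ be the compact group of sequences $x=(x_1,x_2,\dots)$ of zeros and ones under componentwise addition modulo $2$, let $\delta_k\in X$ be the sequence whose $k$-th component is $1$ and whose other components are $0$, and let $\mu_X$ be a Haar measure on $X$. Let $Z$ be an infinite-dimensional separable complex Hilbert space with orthonormal basis $z_1,z_2,\dots$; regard it as a real Hilbert space with inner product $(z,w)=\mathrm{Re}\langle z,w\rangle$, let $\sigma:Z\to Z$ be multiplication by $i$, and let $C(Z)$ be the real Clifford algebra generated by $Z$ with the relations $zw+wz=-2(z,w)1$. The Gårding–Wightman representation $\mathbb J$ of $C(Z)$ associated to the triple $(\mu_X,1,1)$ (that is, $\nu=1$ and $c_k=1$ for all $k$) acts on the complex Hilbert space $H=L^2(X,\mu_X;\mathbb C)$; the map $z\mapsto\mathbb J_z$ is the continuous real-linear map on $Z$ with $$(\mathbb J_{z_k}f)(x)=(-1)^{x_1+\dots+x_{k-1}+1}\,i\,f(x+\delta_k),\qquad (\mathbb J_{\sigma(z_k)}f)(x)=(-1)^{x_k}\,i\,(\mathbb J_{z_k}f)(x)$$ for all $k\ge 1$, $f\in H$ and almost every $x\in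 X$. Then this representation is irreducible over $\mathbb C$ and also over $\mathbb R$: $H\neq 0$, and the only closed complex-linear subspaces of $H$, and likewise the only closed real-linear subspaces of $H$, that are invariant under $C(Z)$ are $\{0\}$ and $H$. -/

import Mathlib

open MeasureTheory Complex
open scoped ENNReal

noncomputable section

namespace GW

/-- The group `X` of sequences of occupation numbers `0`, `1`, under componentwise addition
modulo `2`, with the product topology and the `σ`-algebra generated by the coordinates. -/
abbrev X : Type := ℕ → ZMod 2

/-- The sequence whose `k`-th component is `1` and all of whose other components are `0`. -/
def δ (k : ℕ) : X := Pi.single k 1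

/-- The subgroup of sequences with only finitely many `1`'s, generated by the `δ k`. -/
def Δ : AddSubgroup X := AddSubgroup.closure (Set.range δ)

/-- The translated measure `E ↦ μ (E + d)`. -/
def translate (μ : Measure X) (d : X) : Measure X := μ.map (fun x => x - d)

/-- Parameters `(μ, 1, {c_k})` of a Gårding-Wightman module of multiplicity `ν = 1`
(so that all fibres `H_x` are `ℂ`): a measure `μ` that is quasi-invariant under `Δ`, and unitary
operators `c_k(x)` on `ℂ`, i.e. complex numbers of modulus one, that depend measurably on `x`. -/
structure Triple where
  μ : Measure X
  sigmaFinite : SigmaFinite μ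
  quasiInvariant : ∀ d ∈ Δ, translate μ d ≪ μ ∧ μ ≪ translate μ d
  c : ℕ → X → ℂ
  measurable_c : ∀ k, Measurable (c k)
  norm_c : ∀ k, ∀ᵐ x ∂μ, ‖c k x‖ = 1
  star_c : ∀ k, ∀ᵐ x ∂μ, star (c k x) = c k (x + δ k)
  comm_c : ∀ k l, ∀ᵐ x ∂μ, c k x * c l (x + δ k) = c l x * c k (x + δ l)

attribute [instance] Triple.sigmaFinite

lemma delta_mem (k : ℕ) : δ k ∈ Δ := AddSubgroup.subset_closure ⟨k, rfl⟩

lemma delta_add_self (k : ℕ) : δ k + δ k = 0 := by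
  ext i; exact CharTwo.add_self_eq_zero _

lemma measurableEmbedding_sub (d : X) : MeasurableEmbedding (fun x : X => x - d) :=
  (MeasurableEquiv.subRight d).measurableEmbedding

instance (μ : Measure X) [SigmaFinite μ] (d : X) : SigmaFinite (translate μ d) :=
  (MeasurableEquiv.subRight d).sigmaFinite_map

lemma translate_translate (μ : Measure X) (d e : X) :
    translate (translate μ e) d = translate μ (d + e) := by
  unfold translate
  rw [Measure.map_map (by fun_prop) (by fun_prop)]
  congr 1; ext x i; simp [sub_sub, add_comm]

lemma translate_zero (μ : Measure X) : translate μ 0 = μ := by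
  simp [translate]

namespace Triple

variable (T : Triple)

/-- The Hilbert space `L²(X, μ)` of the module (the direct integral of the fibres `ℂ`). -/
abbrev H : Type := Lp ℂ 2 T.μ

/-- The Radon-Nikodym derivative `dμ(x + d) / dμ(x)`. -/
def rn (d : X) : X → ℝ≥0∞ := (translate T.μ d).rnDeriv T.μ

/-- The function `x ↦ w(x) √(dμ(x + d) / dμ(x)) f(x + d)`. -/
def twistFun (w : X → ℂ) (d : X) (f : X → ℂ) : X → ℂ :=
  fun x => w x * (Real.sqrt (T.rn d x).toReal : ℂ) * f (x + d)

lemma measurable_rn (d : X) : Measurable (T.rn d) := Measure.measurable_rnDeriv _ _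

lemma rn_lt_top (d : X) : ∀ᵐ x ∂T.μ, T.rn d x < ∞ := Measure.rnDeriv_lt_top _ _

lemma quasi {d : X} (hd : d ∈ Δ) :
    Measure.QuasiMeasurePreserving (fun x => x + d) T.μ T.μ := by
  refine ⟨by fun_prop, ?_⟩
  have := (T.quasiInvariant (-d) (neg_mem hd)).1
  simpa [translate] using this

lemma rn_zero : ∀ᵐ x ∂T.μ, T.rn 0 x = 1 := by
  unfold rn
  rw [translate_zero]
  exact Measure.rnDeriv_self T.μ

lemma rn_add {d e : X} (hd : d ∈ Δ) (he : e ∈ Δ) :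
    ∀ᵐ x ∂T.μ, T.rn d x * T.rn e (x + d) = T.rn (d + e) x := by
  have h1 := (measurableEmbedding_sub d).rnDeriv_map (translate T.μ e) T.μ
  have h2 := (T.quasi hd).ae h1
  have hac : translate T.μ (d + e) ≪ translate T.μ d :=
    (T.quasiInvariant _ (add_mem hd he)).1.trans (T.quasiInvariant _ hd).2
  have h3 := Measure.rnDeriv_mul_rnDeriv (κ := T.μ) hac
  filter_upwards [h2, h3] with x hx hx'
  have e1 : Measure.map (fun x => x - d) (translate T.μ e) = translate T.μ (d + e) :=
    translate_translate T.μ d e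
  have e2 : Measure.map (fun x => x - d) T.μ = translate T.μ d := rfl
  rw [e1, e2, add_sub_cancel_right] at hx
  rw [Pi.mul_apply, hx] at hx'
  unfold rn
  rw [mul_comm]; exact hx'

lemma twistFun_congr (w : X → ℂ) {d : X} (hd : d ∈ Δ) {f g : X → ℂ} (h : f =ᵐ[T.μ] g) :
    T.twistFun w d f =ᵐ[T.μ] T.twistFun w d g := by
  filter_upwards [(T.quasi hd).ae h] with x hx
  simp [twistFun, hx]

lemma aesm_twistFun {w : X → ℂ} (hw : Measurable w) {d : X} (hd : d ∈ Δ) {f : X → ℂ}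
    (hf : AEStronglyMeasurable f T.μ) : AEStronglyMeasurable (T.twistFun w d f) T.μ := by
  have h1 := hf.comp_quasiMeasurePreserving (T.quasi hd)
  have h2 : Measurable fun x => w x * (Real.sqrt (T.rn d x).toReal : ℂ) :=
    hw.mul (measurable_ofReal.comp (T.measurable_rn d).ennreal_toReal.sqrt)
  exact h2.aestronglyMeasurable.mul h1

lemma eLpNorm_twistFun {w : X → ℂ} (hw1 : ∀ᵐ x ∂T.μ, ‖w x‖ = 1) {d : X}
    (hd : d ∈ Δ) {f : X → ℂ} (hf : AEStronglyMeasurable f T.μ) :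
    eLpNorm (T.twistFun w d f) 2 T.μ = eLpNorm f 2 T.μ := by
  rw [eLpNorm_eq_lintegral_rpow_enorm_toReal (by norm_num) (by norm_num),
    eLpNorm_eq_lintegral_rpow_enorm_toReal (by norm_num) (by norm_num)]
  congr 1
  have hac := (T.quasiInvariant d hd).1
  have hm : AEMeasurable (fun x => ‖f (x + d)‖ₑ ^ (2 : ℝ≥0∞).toReal) T.μ :=
    (hf.comp_quasiMeasurePreserving (T.quasi hd)).enorm.pow_const _
  have h := lintegral_rnDeriv_mul hac hm
  have h2 : ∫⁻ x, ‖f (x + d)‖ₑ ^ (2 : ℝ≥0∞).toReal ∂(translate T.μ d)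
      = ∫⁻ x, ‖f x‖ₑ ^ (2 : ℝ≥0∞).toReal ∂T.μ := by
    unfold translate
    rw [(measurableEmbedding_sub d).lintegral_map]
    simp
  rw [← h2, ← h]
  refine lintegral_congr_ae ?_
  filter_upwards [hw1, T.rn_lt_top d] with x hx hx'
  have h3 : ‖w x‖ₑ = 1 := by rw [← ofReal_norm, hx]; simp
  simp only [twistFun, enorm_mul, h3, one_mul]
  rw [ENNReal.mul_rpow_of_nonneg _ _ (by simp)]
  congr 1
  rw [← ofReal_norm, Complex.norm_real, Real.norm_of_nonneg (Real.sqrt_nonneg _)]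
  simp only [ENNReal.toReal_ofNat, ENNReal.rpow_ofNat]
  rw [← ENNReal.ofReal_pow (Real.sqrt_nonneg _), Real.sq_sqrt ENNReal.toReal_nonneg,
    ENNReal.ofReal_toReal hx'.ne]
  rfl

lemma memLp_twistFun {w : X → ℂ} (hw : Measurable w) (hw1 : ∀ᵐ x ∂T.μ, ‖w x‖ = 1) {d : X}
    (hd : d ∈ Δ) (f : T.H) : MemLp (T.twistFun w d f) 2 T.μ :=
  ⟨T.aesm_twistFun hw hd (Lp.aestronglyMeasurable f), by
    rw [T.eLpNorm_twistFun hw1 hd (Lp.aestronglyMeasurable f)]; exact Lp.eLpNorm_lt_top f⟩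

/-- The bounded operator `(twist f)(x) = w(x) √(dμ(x + d) / dμ(x)) f(x + d)` on `L²(X, μ)`,
for `w` measurable of modulus one and `d ∈ Δ`. -/
def twist (w : X → ℂ) (hw : Measurable w) (hw1 : ∀ᵐ x ∂T.μ, ‖w x‖ = 1) (d : X) (hd : d ∈ Δ) :
    T.H →L[ℂ] T.H :=
  LinearIsometry.toContinuousLinearMap
    { toFun := fun f => (T.memLp_twistFun hw hw1 hd f).toLp
      map_add' := by
        intro f g
        rw [← MemLp.toLp_add, MemLp.toLp_eq_toLp_iff]
        filter_upwards [(T.quasi hd).ae (Lp.coeFn_add f g)] with x hx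
        simp only [twistFun, Pi.add_apply, hx]; ring
      map_smul' := by
        intro a f
        rw [RingHom.id_apply, ← MemLp.toLp_const_smul, MemLp.toLp_eq_toLp_iff]
        filter_upwards [(T.quasi hd).ae (Lp.coeFn_smul a f)] with x hx
        simp only [twistFun, Pi.smul_apply, smul_eq_mul, hx]; ring
      norm_map' := by
        intro f
        simp only [LinearMap.coe_mk, AddHom.coe_mk]
        rw [Lp.norm_toLp, T.eLpNorm_twistFun hw1 hd (Lp.aestronglyMeasurable f), Lp.norm_def] }

lemma twist_coeFn (w : X → ℂ) (hw : Measurable w) (hw1 : ∀ᵐ x ∂T.μ, ‖w x‖ = 1) (d : X)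
    (hd : d ∈ Δ) (f : T.H) : T.twist w hw hw1 d hd f =ᵐ[T.μ] T.twistFun w d f :=
  (T.memLp_twistFun hw hw1 hd f).coeFn_toLp

lemma norm_twist (w : X → ℂ) (hw : Measurable w) (hw1 : ∀ᵐ x ∂T.μ, ‖w x‖ = 1) (d : X)
    (hd : d ∈ Δ) (f : T.H) : ‖T.twist w hw hw1 d hd f‖ = ‖f‖ := by
  rw [Lp.norm_def, Lp.norm_def, eLpNorm_congr_ae (T.twist_coeFn w hw hw1 d hd f),
    T.eLpNorm_twistFun hw1 hd (Lp.aestronglyMeasurable f)]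

lemma twist_twist (w : X → ℂ) (hw : Measurable w) (hw1 : ∀ᵐ x ∂T.μ, ‖w x‖ = 1) (d : X)
    (hd : d ∈ Δ) (v : X → ℂ) (hv : Measurable v) (hv1 : ∀ᵐ x ∂T.μ, ‖v x‖ = 1) (e : X)
    (he : e ∈ Δ) (f : T.H) :
    T.twist w hw hw1 d hd (T.twist v hv hv1 e he f) =ᵐ[T.μ]
      T.twistFun (fun x => w x * v (x + d)) (d + e) f := by
  refine (T.twist_coeFn w hw hw1 d hd _).trans
    ((T.twistFun_congr w hd (T.twist_coeFn v hv hv1 e he f)).trans ?_)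
  filter_upwards [T.rn_add hd he] with x hx
  have : Real.sqrt (T.rn (d + e) x).toReal
      = Real.sqrt (T.rn d x).toReal * Real.sqrt (T.rn e (x + d)).toReal := by
    rw [← hx, ENNReal.toReal_mul, Real.sqrt_mul ENNReal.toReal_nonneg]
  simp only [twistFun, this, ofReal_mul, add_assoc]
  ring

/-- The factor `(-1)^{x_1 + ⋯ + x_{k-1} + 1} i c_k(x)` (the indices start from `0` here). -/
def weightZ (k : ℕ) : X → ℂ :=
  fun x => (-1) ^ ((∑ j ∈ Finset.range k, (x j).val) + 1) * I * T.c k x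

/-- The factor `(-1)^{x_k} i · (-1)^{x_1 + ⋯ + x_{k-1} + 1} i c_k(x)`. -/
def weightσ (k : ℕ) : X → ℂ := fun x => (-1) ^ (x k).val * I * T.weightZ k x

lemma measurable_val (k : ℕ) : Measurable fun x : X => (x k).val :=
  (measurable_of_countable (fun a : ZMod 2 => a.val)).comp (measurable_pi_apply k)

lemma measurable_sign (g : X → ℕ) (hg : Measurable g) : Measurable fun x => (-1 : ℂ) ^ g x :=
  (measurable_of_countable (fun n : ℕ => (-1 : ℂ) ^ n)).comp hg

lemma measurable_weightZ (k : ℕ) : Measurable (T.weightZ k) := by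
  refine Measurable.mul (Measurable.mul_const (measurable_sign _ ?_) _) (T.measurable_c k)
  exact (Finset.measurable_sum _ fun j _ => measurable_val j).add_const 1

lemma measurable_weightσ (k : ℕ) : Measurable (T.weightσ k) :=
  ((measurable_sign _ (measurable_val k)).mul_const _).mul (T.measurable_weightZ k)

lemma norm_weightZ (k : ℕ) : ∀ᵐ x ∂T.μ, ‖T.weightZ k x‖ = 1 := by
  filter_upwards [T.norm_c k] with x hx
  simp [weightZ, hx]

lemma norm_weightσ (k : ℕ) : ∀ᵐ x ∂T.μ, ‖T.weightσ k x‖ = 1 := by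
  filter_upwards [T.norm_weightZ k] with x hx
  simp [weightσ, hx]

/-- The operator of the basis vector `z_k`:
`(J f)(x) = (-1)^{x_1 + ⋯ + x_{k-1} + 1} i c_k(x) √(dμ(x + δ_k) / dμ(x)) f(x + δ_k)`. -/
def opZ (k : ℕ) : T.H →L[ℂ] T.H :=
  T.twist (T.weightZ k) (T.measurable_weightZ k) (T.norm_weightZ k) (δ k) (delta_mem k)

/-- The operator of the basis vector `σ(z_k)`: `(J' f)(x) = (-1)^{x_k} i (J f)(x)`, where `J`
is the operator of `z_k`. -/
def opσ (k : ℕ) : T.H →L[ℂ] T.H :=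
  T.twist (T.weightσ k) (T.measurable_weightσ k) (T.norm_weightσ k) (δ k) (delta_mem k)

lemma opZ_apply (k : ℕ) (f : T.H) : ∀ᵐ x ∂T.μ, T.opZ k f x =
    (-1) ^ ((∑ j ∈ Finset.range k, (x j).val) + 1) * I * T.c k x *
      (Real.sqrt (((translate T.μ (δ k)).rnDeriv T.μ x).toReal) : ℂ) * f (x + δ k) :=
  T.twist_coeFn _ _ _ _ _ f

lemma opσ_apply (k : ℕ) (f : T.H) : ∀ᵐ x ∂T.μ, T.opσ k f x =
    (-1) ^ (x k).val * I * T.opZ k f x := by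
  filter_upwards [T.twist_coeFn _ (T.measurable_weightσ k) (T.norm_weightσ k) (δ k)
    (delta_mem k) f, T.twist_coeFn _ (T.measurable_weightZ k) (T.norm_weightZ k) (δ k)
    (delta_mem k) f] with x hx hx'
  rw [opσ, opZ, hx, hx']
  simp only [twistFun, weightσ]; ring

lemma sign_flip (a : ZMod 2) : (-1 : ℂ) ^ (a + 1).val = -(-1) ^ a.val := by
  have h : ∀ a : ZMod 2, (a + 1).val = 1 - a.val ∧ (a.val = 0 ∨ a.val = 1) := by decide
  obtain ⟨h1, h2 | h2⟩ := h a <;> simp [h1, h2]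

lemma sign_add_delta (x : X) (k l : ℕ) : (-1 : ℂ) ^ ((x + δ l) k).val =
    (if l = k then -1 else 1) * (-1) ^ (x k).val := by
  split_ifs with h
  · subst h
    simp [δ, sign_flip]
  · simp [δ, Pi.single_eq_of_ne (Ne.symm h)]

lemma signs_add_delta (x : X) (k l : ℕ) :
    (-1 : ℂ) ^ ((∑ j ∈ Finset.range k, ((x + δ l) j).val) + 1) =
      (if l < k then -1 else 1) * (-1) ^ ((∑ j ∈ Finset.range k, (x j).val) + 1) := by
  rw [pow_succ, pow_succ, ← Finset.prod_pow_eq_pow_sum, ← Finset.prod_pow_eq_pow_sum,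
    Finset.prod_congr rfl fun j _ => sign_add_delta x j l, Finset.prod_mul_distrib,
    Finset.prod_ite_eq]
  simp only [Finset.mem_range]; ring

lemma neg_one_pow_mul_self (n : ℕ) : ((-1 : ℂ) ^ n) * (-1) ^ n = 1 := by
  rw [← pow_add, ← two_mul, pow_mul]; simp

lemma weightZ_add_delta (k l : ℕ) (x : X) : T.weightZ k (x + δ l) =
    (if l < k then -1 else 1) * (-1) ^ ((∑ j ∈ Finset.range k, (x j).val) + 1) * I *
      T.c k (x + δ l) := by
  rw [weightZ, signs_add_delta]

lemma c_mul_c (k : ℕ) : ∀ᵐ x ∂T.μ, T.c k x * T.c k (x + δ k) = 1 := by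
  filter_upwards [T.norm_c k, T.star_c k] with x hx hx'
  rw [← hx']
  have := Complex.mul_conj (T.c k x)
  rw [Complex.normSq_eq_norm_sq, hx] at this
  simpa using this

lemma weightZ_mul_self (k : ℕ) : ∀ᵐ x ∂T.μ, T.weightZ k x * T.weightZ k (x + δ k) = -1 := by
  filter_upwards [T.c_mul_c k] with x hx
  rw [weightZ_add_delta, weightZ]
  have h := neg_one_pow_mul_self ((∑ j ∈ Finset.range k, (x j).val) + 1)
  simp only [lt_self_iff_false, if_false]
  linear_combination (I * I * T.c k x * T.c k (x + δ k)) * h + I * I * hx + Complex.I_mul_I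

lemma weightZ_mul_comm {k l : ℕ} (hkl : k ≠ l) : ∀ᵐ x ∂T.μ,
    T.weightZ k x * T.weightZ l (x + δ k) = -(T.weightZ l x * T.weightZ k (x + δ l)) := by
  filter_upwards [T.comm_c k l] with x hx
  rw [weightZ_add_delta, weightZ_add_delta, weightZ, weightZ]
  rcases lt_or_gt_of_ne hkl with h | h
  · simp only [h, h.not_gt, if_true, if_false]
    linear_combination (-(I * I) * (-1) ^ ((∑ j ∈ Finset.range k, (x j).val) + 1) *
      (-1) ^ ((∑ j ∈ Finset.range l, (x j).val) + 1)) * hx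
  · simp only [h, h.not_gt, if_true, if_false]
    linear_combination ((I * I) * (-1) ^ ((∑ j ∈ Finset.range k, (x j).val) + 1) *
      (-1) ^ ((∑ j ∈ Finset.range l, (x j).val) + 1)) * hx

/-- The operators of the real orthonormal basis `{z_k, σ(z_k)}`, as one family. -/
def op : ℕ ⊕ ℕ → T.H →L[ℂ] T.H := Sum.elim T.opZ T.opσ

lemma norm_op (i : ℕ ⊕ ℕ) (f : T.H) : ‖T.op i f‖ = ‖f‖ := by
  rcases i with k | k
  · exact T.norm_twist _ (T.measurable_weightZ k) (T.norm_weightZ k) _ (delta_mem k) f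
  · exact T.norm_twist _ (T.measurable_weightσ k) (T.norm_weightσ k) _ (delta_mem k) f

lemma weightσ_add_delta (k l : ℕ) (x : X) : T.weightσ k (x + δ l) =
    (if l = k then -1 else 1) * (-1) ^ (x k).val * I * T.weightZ k (x + δ l) := by
  rw [weightσ, sign_add_delta]

lemma twist_mul_self (w : X → ℂ) (hw : Measurable w) (hw1 : ∀ᵐ x ∂T.μ, ‖w x‖ = 1) (k : ℕ)
    (h : ∀ᵐ x ∂T.μ, w x * w (x + δ k) = -1) :
    T.twist w hw hw1 (δ k) (delta_mem k) * T.twist w hw hw1 (δ k) (delta_mem k) = -1 := by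
  ext1 f
  apply Lp.ext
  refine (T.twist_twist w hw hw1 _ (delta_mem k) w hw hw1 _ (delta_mem k) f).trans ?_
  change _ =ᵐ[T.μ] ((-f : T.H) : X → ℂ)
  filter_upwards [h, T.rn_zero, Lp.coeFn_neg f] with x hx hx' hf
  rw [twistFun, hf, delta_add_self, hx, hx']
  simp

lemma twist_mul_comm (w : X → ℂ) (hw : Measurable w) (hw1 : ∀ᵐ x ∂T.μ, ‖w x‖ = 1) (k : ℕ)
    (v : X → ℂ) (hv : Measurable v) (hv1 : ∀ᵐ x ∂T.μ, ‖v x‖ = 1) (l : ℕ)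
    (h : ∀ᵐ x ∂T.μ, w x * v (x + δ k) = -(v x * w (x + δ l))) :
    T.twist w hw hw1 (δ k) (delta_mem k) * T.twist v hv hv1 (δ l) (delta_mem l) =
      -(T.twist v hv hv1 (δ l) (delta_mem l) * T.twist w hw hw1 (δ k) (delta_mem k)) := by
  ext1 f
  apply Lp.ext
  refine (T.twist_twist w hw hw1 _ (delta_mem k) v hv hv1 _ (delta_mem l) f).trans ?_
  change _ =ᵐ[T.μ] ((-(T.twist v hv hv1 (δ l) (delta_mem l)
    (T.twist w hw hw1 (δ k) (delta_mem k) f)) : T.H) : X → ℂ)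
  filter_upwards [h, Lp.coeFn_neg (T.twist v hv hv1 (δ l) (delta_mem l)
    (T.twist w hw hw1 (δ k) (delta_mem k) f)),
    T.twist_twist v hv hv1 (δ l) (delta_mem l) w hw hw1 (δ k) (delta_mem k) f] with x hx hf hg
  rw [hf, Pi.neg_apply, hg]
  simp only [twistFun, hx, add_comm (δ l) (δ k)]; ring

lemma op_mul_self (i : ℕ ⊕ ℕ) : T.op i * T.op i = -1 := by
  rcases i with k | k
  · exact T.twist_mul_self _ (T.measurable_weightZ k) (T.norm_weightZ k) _ (T.weightZ_mul_self k)
  · refine T.twist_mul_self _ (T.measurable_weightσ k) (T.norm_weightσ k) _ ?_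
    filter_upwards [T.weightZ_mul_self k] with x hx
    rw [weightσ_add_delta, weightσ, if_pos rfl]
    linear_combination (-(I * I) * (T.weightZ k x * T.weightZ k (x + δ k))) *
      neg_one_pow_mul_self (x k).val - I * I * hx + Complex.I_mul_I

lemma op_mul_comm {i j : ℕ ⊕ ℕ} (hij : i ≠ j) : T.op i * T.op j = -(T.op j * T.op i) := by
  rcases i with k | k <;> rcases j with l | l
  · exact T.twist_mul_comm _ (T.measurable_weightZ k) (T.norm_weightZ k) _ _
      (T.measurable_weightZ l) (T.norm_weightZ l) _ (T.weightZ_mul_comm fun h => hij (h ▸ rfl))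
  · refine T.twist_mul_comm _ (T.measurable_weightZ k) (T.norm_weightZ k) _ _
      (T.measurable_weightσ l) (T.norm_weightσ l) _ ?_
    by_cases h : k = l
    · subst h
      refine Filter.Eventually.of_forall fun x => ?_
      rw [weightσ_add_delta, weightσ, if_pos rfl]; ring
    · filter_upwards [T.weightZ_mul_comm h] with x hx
      rw [weightσ_add_delta, weightσ, if_neg h]
      linear_combination ((-1) ^ (x l).val * I) * hx
  · refine T.twist_mul_comm _ (T.measurable_weightσ k) (T.norm_weightσ k) _ _
      (T.measurable_weightZ l) (T.norm_weightZ l) _ ?_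
    by_cases h : k = l
    · subst h
      refine Filter.Eventually.of_forall fun x => ?_
      rw [weightσ_add_delta, weightσ, if_pos rfl]; ring
    · filter_upwards [T.weightZ_mul_comm h] with x hx
      rw [weightσ_add_delta, weightσ, if_neg (Ne.symm h)]
      linear_combination ((-1) ^ (x k).val * I) * hx
  · have h : k ≠ l := fun h => hij (h ▸ rfl)
    refine T.twist_mul_comm _ (T.measurable_weightσ k) (T.norm_weightσ k) _ _
      (T.measurable_weightσ l) (T.norm_weightσ l) _ ?_
    filter_upwards [T.weightZ_mul_comm h] with x hx
    rw [weightσ_add_delta, weightσ_add_delta, weightσ, weightσ, if_neg h, if_neg (Ne.symm h)]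
    linear_combination ((-1) ^ (x k).val * I * (-1) ^ (x l).val * I) * hx

end Triple

section Sum

variable {H ι : Type*} [NormedAddCommGroup H] [InnerProductSpace ℂ H]
  {J : ι → H →L[ℂ] H}

lemma re_inner_eq_zero (hn : ∀ i f, ‖J i f‖ = ‖f‖) (hs : ∀ i, J i * J i = -1)
    (hc : ∀ i j, i ≠ j → J i * J j = -(J j * J i)) {i j : ι} (hij : i ≠ j) (f : H) :
    (inner ℂ (J i f) (J j f)).re = 0 := by
  have hin : ∀ i f g, inner ℂ (J i f) (J i g) = inner ℂ f g := fun i f g =>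
    (LinearIsometry.mk (J i).toLinearMap (hn i)).inner_map_map f g
  have hsk : ∀ i f g, inner ℂ (J i f) g = -inner ℂ f (J i g) := fun i f g => by
    have h : J i (J i g) = -g := congrArg (fun A : H →L[ℂ] H => A g) (hs i)
    rw [← hin i f (J i g), h, inner_neg_right, neg_neg]
  have h1 : J i (J j f) = -J j (J i f) :=
    congrArg (fun A : H →L[ℂ] H => A f) (hc i j hij)
  have h2 : inner ℂ (J i f) (J j f) = -inner ℂ (J j f) (J i f) := by
    rw [hsk i f, h1, inner_neg_right, neg_neg, hsk j f, neg_neg]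
  have h3 := congrArg Complex.re h2
  rw [Complex.neg_re, ← inner_conj_symm (J j f) (J i f), Complex.conj_re] at h3
  linarith

lemma norm_sum_sq (hn : ∀ i f, ‖J i f‖ = ‖f‖) (hs : ∀ i, J i * J i = -1)
    (hc : ∀ i j, i ≠ j → J i * J j = -(J j * J i)) (a : ι → ℝ) (s : Finset ι) (f : H) :
    ‖(∑ i ∈ s, a i • J i) f‖ ^ 2 = (∑ i ∈ s, a i ^ 2) * ‖f‖ ^ 2 := by
  classical
  induction s using Finset.induction_on with
  | empty => simp
  | insert i s hi ih =>
    rw [Finset.sum_insert hi, Finset.sum_insert hi, add_apply,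
      @norm_add_sq ℂ, ih]
    have h0 : RCLike.re (inner ℂ ((a i • J i) f) ((∑ i ∈ s, a i • J i) f)) = 0 := by
      rw [sum_apply, inner_sum, map_sum]
      refine Finset.sum_eq_zero fun j hj => ?_
      have hij : i ≠ j := fun h => hi (h ▸ hj)
      have h := re_inner_eq_zero hn hs hc hij f
      simp only [smul_apply, ← Complex.coe_smul, inner_smul_left,
        inner_smul_right, Complex.conj_ofReal, RCLike.re_to_complex, Complex.re_ofReal_mul, h,
        mul_zero]
    rw [h0, smul_apply, norm_smul, hn, mul_pow, Real.norm_eq_abs, sq_abs]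
    ring

lemma sum_mul_self (hs : ∀ i, J i * J i = -1)
    (hc : ∀ i j, i ≠ j → J i * J j = -(J j * J i)) (a : ι → ℝ) (s : Finset ι) :
    (∑ i ∈ s, a i • J i) * (∑ i ∈ s, a i • J i) = -(∑ i ∈ s, a i ^ 2) • 1 := by
  classical
  induction s using Finset.induction_on with
  | empty => simp
  | insert i s hi ih =>
    have h0 : a i • J i * ∑ j ∈ s, a j • J j = -((∑ j ∈ s, a j • J j) * a i • J i) := by
      rw [Finset.mul_sum, Finset.sum_mul, ← Finset.sum_neg_distrib]
      refine Finset.sum_congr rfl fun j hj => ?_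
      have hij : i ≠ j := fun h => hi (h ▸ hj)
      rw [smul_mul_smul_comm, smul_mul_smul_comm, hc i j hij, smul_neg, mul_comm]
    rw [Finset.sum_insert hi, Finset.sum_insert hi, mul_add, add_mul, add_mul, ih, h0,
      smul_mul_smul_comm, hs]
    module

lemma summable_smul [CompleteSpace H] (hn : ∀ i f, ‖J i f‖ = ‖f‖) (hs : ∀ i, J i * J i = -1)
    (hc : ∀ i j, i ≠ j → J i * J j = -(J j * J i)) {a : ι → ℝ}
    (ha : Summable fun i => a i ^ 2) : Summable fun i => a i • J i := by
  rw [summable_iff_vanishing_norm] at ha ⊢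
  intro ε hε
  obtain ⟨s, hs'⟩ := ha ((ε / 2) ^ 2) (by positivity)
  refine ⟨s, fun t ht => ?_⟩
  have h1 := hs' t ht
  rw [Real.norm_of_nonneg (Finset.sum_nonneg fun i _ => sq_nonneg _)] at h1
  refine lt_of_le_of_lt (ContinuousLinearMap.opNorm_le_bound _ (by positivity : 0 ≤ ε / 2)
    fun f => ?_) (half_lt_self hε)
  refine (sq_le_sq₀ (norm_nonneg _) (by positivity)).1 ?_
  rw [norm_sum_sq hn hs hc, mul_pow]
  gcongr

end Sum

section Rep

variable {Z : Type*} [NormedAddCommGroup Z] [InnerProductSpace ℂ Z]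

/-- The real quadratic form `z ↦ -(z, z)`. Its Clifford algebra is generated by `Z` with the
relations `z w + w z = -2 (z, w)`, where `(z, w)` is the real inner product. -/
def cliffordForm (Z : Type*) [NormedAddCommGroup Z] [InnerProductSpace ℂ Z] :
    QuadraticForm ℝ Z :=
  letI : InnerProductSpace ℝ Z := InnerProductSpace.complexToReal;
  -LinearMap.BilinMap.toQuadraticMap (innerₗ Z)

lemma cliffordForm_apply (z : Z) : cliffordForm Z z = -‖z‖ ^ 2 := by
  let _ : InnerProductSpace ℝ Z := InnerProductSpace.complexToReal
  simp [cliffordForm]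

/-- The coordinates of `z` in the real orthonormal basis `{z_k, σ(z_k)}`, where `z_k = b k` is
a unitary basis of `Z` and `σ` is multiplication by `i`. -/
def coord (b : HilbertBasis ℕ ℂ Z) (z : Z) : ℕ ⊕ ℕ → ℝ :=
  Sum.elim (fun k => (b.repr z k).re) (fun k => (b.repr z k).im)

lemma hasSum_coord_sq (b : HilbertBasis ℕ ℂ Z) (z : Z) :
    HasSum (fun i => coord b z i ^ 2) (‖z‖ ^ 2) := by
  have h : HasSum (fun k => ‖b.repr z k‖ ^ 2) (‖z‖ ^ 2) := by
    have := lp.hasSum_norm (p := 2) (by norm_num) (b.repr z)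
    simpa using this
  have hre : Summable fun k => (b.repr z k).re ^ 2 :=
    Summable.of_nonneg_of_le (fun _ => sq_nonneg _) (fun k => by
      rw [← Complex.normSq_eq_norm_sq, Complex.normSq_apply]
      nlinarith [sq_nonneg (b.repr z k).im]) h.summable
  have him : Summable fun k => (b.repr z k).im ^ 2 :=
    Summable.of_nonneg_of_le (fun _ => sq_nonneg _) (fun k => by
      rw [← Complex.normSq_eq_norm_sq, Complex.normSq_apply]
      nlinarith [sq_nonneg (b.repr z k).re]) h.summable
  have h2 := hre.hasSum.add him.hasSum
  have h3 : (fun k => (b.repr z k).re ^ 2 + (b.repr z k).im ^ 2) =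
      fun k => ‖b.repr z k‖ ^ 2 := by
    funext k
    rw [← Complex.normSq_eq_norm_sq, Complex.normSq_apply]; ring
  rw [h3] at h2
  rw [h.unique h2]
  exact HasSum.sum (f := fun i => coord b z i ^ 2) hre.hasSum him.hasSum

namespace Triple

variable (T : Triple) (b : HilbertBasis ℕ ℂ Z)

lemma summable_op (z : Z) : Summable fun i => coord b z i • T.op i :=
  summable_smul T.norm_op T.op_mul_self (fun _ _ h => T.op_mul_comm h)
    (hasSum_coord_sq b z).summable

/-- The real-linear map `z ↦ 𝕁_z`: the continuous real-linear extension to `Z` of the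
prescription that `z_k` and `σ(z_k)` act by `opZ k` and `opσ k`. -/
def J : Z →ₗ[ℝ] T.H →L[ℂ] T.H where
  toFun z := ∑' i, coord b z i • T.op i
  map_add' z w := by
    rw [← (T.summable_op b z).tsum_add (T.summable_op b w)]
    refine tsum_congr fun i => ?_
    rw [← add_smul]
    rcases i with k | k <;> simp [coord]
  map_smul' r z := by
    rw [RingHom.id_apply, ← (T.summable_op b z).tsum_const_smul]
    refine tsum_congr fun i => ?_
    rw [← mul_smul]
    have h : b.repr (r • z) = (r : ℂ) • b.repr z := by
      rw [← map_smul, Complex.coe_smul]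
    have hk : ∀ k, b.repr (r • z) k = (r : ℂ) * b.repr z k := fun k => by rw [h]; rfl
    rcases i with k | k <;>
      simp only [coord, Sum.elim_inl, Sum.elim_inr, hk, re_ofReal_mul, im_ofReal_mul]

lemma J_basis (k : ℕ) : T.J b (b k) = T.opZ k := by
  change ∑' i, coord b (b k) i • T.op i = T.opZ k
  rw [tsum_eq_single (Sum.inl k)]
  · simp [coord, op, b.repr_self]
  · rintro (l | l) h
    · have : l ≠ k := fun e => h (e ▸ rfl)
      simp [coord, b.repr_self, this]
    · by_cases e : l = k
      · subst e; simp [coord, b.repr_self]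
      · simp [coord, b.repr_self, e]

lemma J_I_smul_basis (k : ℕ) : T.J b (I • b k) = T.opσ k := by
  change ∑' i, coord b (I • b k) i • T.op i = T.opσ k
  rw [tsum_eq_single (Sum.inr k)]
  · simp [coord, op, b.repr_self]
  · rintro (l | l) h
    · by_cases e : l = k
      · subst e; simp [coord, b.repr_self]
      · simp [coord, b.repr_self, e]
    · have : l ≠ k := fun e => h (e ▸ rfl)
      simp [coord, b.repr_self, this]

lemma J_mul_self (z : Z) : T.J b z * T.J b z = algebraMap ℝ _ (cliffordForm Z z) := by
  have h1 : HasSum (fun i => coord b z i • T.op i) (T.J b z) := (T.summable_op b z).hasSum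
  have h2 : Filter.Tendsto (fun s : Finset (ℕ ⊕ ℕ) =>
      (∑ i ∈ s, coord b z i • T.op i) * (∑ i ∈ s, coord b z i • T.op i)) Filter.atTop
      (nhds (T.J b z * T.J b z)) := Filter.Tendsto.mul h1 h1
  have h3 : Filter.Tendsto (fun s : Finset (ℕ ⊕ ℕ) =>
      -(∑ i ∈ s, coord b z i ^ 2) • (1 : T.H →L[ℂ] T.H)) Filter.atTop
      (nhds (-(‖z‖ ^ 2) • 1)) :=
    (Filter.Tendsto.neg (hasSum_coord_sq b z)).smul_const _
  have h4 := h3.congr fun s =>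
    (sum_mul_self T.op_mul_self (fun _ _ h => T.op_mul_comm h) (coord b z) s).symm
  rw [tendsto_nhds_unique h2 h4, cliffordForm_apply, Algebra.algebraMap_eq_smul_one]

lemma norm_J_apply (z : Z) (f : T.H) : ‖T.J b z f‖ = ‖z‖ * ‖f‖ := by
  have h1 : HasSum (fun i => coord b z i • T.op i) (T.J b z) := (T.summable_op b z).hasSum
  have h2 : Filter.Tendsto (fun s : Finset (ℕ ⊕ ℕ) =>
      ‖(∑ i ∈ s, coord b z i • T.op i) f‖ ^ 2) Filter.atTop (nhds (‖T.J b z f‖ ^ 2)) :=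
    (((ContinuousLinearMap.apply ℂ T.H f).continuous.tendsto _).comp h1).norm.pow 2
  have h4 : Filter.Tendsto (fun s : Finset (ℕ ⊕ ℕ) => (∑ i ∈ s, coord b z i ^ 2) * ‖f‖ ^ 2)
      Filter.atTop (nhds (‖z‖ ^ 2 * ‖f‖ ^ 2)) :=
    Filter.Tendsto.mul_const _ (hasSum_coord_sq b z)
  have h5 := h4.congr fun s => (norm_sum_sq T.norm_op T.op_mul_self
    (fun _ _ h => T.op_mul_comm h) (coord b z) s f).symm
  have h6 := tendsto_nhds_unique h2 h5
  rw [← mul_pow] at h6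
  exact (sq_eq_sq₀ (norm_nonneg _) (by positivity)).1 h6

/-- The Gårding-Wightman representation of the real Clifford algebra `C(Z)` on `L²(X, μ)`
associated to the triple `T = (μ, 1, {c_k})` and the unitary basis `b` of `Z`. -/
def rep : CliffordAlgebra (cliffordForm Z) →ₐ[ℝ] (T.H →L[ℂ] T.H) :=
  CliffordAlgebra.lift (cliffordForm Z) ⟨T.J b, T.J_mul_self b⟩

end Triple

end Rep

/-- A representation `π` of a real algebra on a complex Hilbert space `H` is irreducible over
`𝕜` (`ℝ` or `ℂ`) if `H ≠ 0` and no closed `𝕜`-linear subspaces other than `0` and `H` are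
invariant. -/
def IrreducibleOver (𝕜 : Type*) {A H : Type*} [Ring A] [Algebra ℝ A] [NormedAddCommGroup H]
    [InnerProductSpace ℂ H] [Semiring 𝕜] [Module 𝕜 H] (π : A →ₐ[ℝ] (H →L[ℂ] H)) : Prop :=
  Nontrivial H ∧ ∀ U : Submodule 𝕜 H, IsClosed (U : Set H) →
    (∀ a : A, ∀ f ∈ U, π a f ∈ U) → U = ⊥ ∨ U = ⊤

lemma translate_haar (μ : Measure X) [μ.IsAddHaarMeasure] (d : X) : translate μ d = μ := by
  have h : (fun x : X => x - d) = fun x => x + -d := funext fun x => sub_eq_add_neg x d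
  rw [translate, h]
  exact map_add_right_eq_self μ (-d)

/-- The triple `(μ, 1, 1)` with `μ` a Haar measure on `X`. -/
def haarTriple (μ : Measure X) [μ.IsAddHaarMeasure] : Triple where
  μ := μ
  sigmaFinite := inferInstance
  quasiInvariant d _ := by
    rw [translate_haar]
    exact ⟨Measure.AbsolutelyContinuous.rfl, Measure.AbsolutelyContinuous.rfl⟩
  c _ _ := 1
  measurable_c _ := measurable_const
  norm_c _ := by simp
  star_c _ := by simp
  comm_c _ _ := by simp

end GW

end

/-! Two ingredients generate the representation: the multiplications `M_k` by the sign `(-1)^{x_k}`,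
and the translations by `δ k`. Indeed `opσ k * opZ k = -i M_k`, and `opZ k` is `-i` times the
translation by `δ k` followed by the product of the `M_j` with `j < k` (indices start at 0).

If a closed real subspace `U` is invariant, its real orthogonal projection `P` commutes with every
`opZ k` and `opσ k`, because these are skew isometries. Splitting `P` into its complex-linear and
antilinear parts, it suffices to study a bounded real-linear `D` that commutes with these operators
and satisfies `D i = s i D` with `s = 1` or `s = -1`. The factors `i` in the two formulas give `D
M_k = s M_k D` and, for the constant function `e = 1`, that translation by `δ k` multiplies `D e` by
`s ^ (k + 1)`. Since the Walsh functions `M_S e` are total, `D` is determined by `D e`.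

For `s = 1`, `D e` is translation invariant, hence orthogonal to every nonconstant Walsh function:
it is a multiple `c e`, and `D = c` (`exists_eq_smul`). For `s = -1`, `D e` changes sign under `δ k`
for every even `k`, whereas a Walsh function involves only finitely many coordinates; so `D e` is
orthogonal to all of them and `D = 0` (`eq_zero_of_antilinear`). Thus `P` is a complex scalar and
`U` is trivial. The complex case follows, a complex subspace being a real one. -/

noncomputable section

namespace GW

/-! ### Walsh functions and their totality in `C(X)` -/

/-- The character `x ↦ (-1)^{x_k}` of `X`. -/
def coordSign (k : ℕ) : C(X, ℂ) :=
  ⟨fun x => (-1) ^ (x k).val,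
    (continuous_of_discreteTopology (f := fun a : ZMod 2 => (-1 : ℂ) ^ a.val)).comp
      (continuous_apply k)⟩

/-- The Walsh function `x ↦ ∏_{k ∈ S} (-1)^{x_k}`. -/
def walsh (S : Finset ℕ) : C(X, ℂ) := ∏ k ∈ S, coordSign k

lemma coordSign_apply (k : ℕ) (x : X) : coordSign k x = (-1) ^ (x k).val := rfl

lemma walsh_apply (S : Finset ℕ) (x : X) : walsh S x = ∏ k ∈ S, (-1 : ℂ) ^ (x k).val := by
  simp [walsh, coordSign_apply]

lemma walsh_range_apply (k : ℕ) (x : X) :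
    walsh (Finset.range k) x = (-1) ^ (∑ j ∈ Finset.range k, (x j).val) := by
  rw [walsh_apply, Finset.prod_pow_eq_pow_sum]

lemma walsh_empty : walsh ∅ = 1 := by simp [walsh]

lemma walsh_insert {k : ℕ} {S : Finset ℕ} (h : k ∉ S) :
    walsh (insert k S) = coordSign k * walsh S := Finset.prod_insert h

lemma coordSign_mul_self (k : ℕ) : coordSign k * coordSign k = 1 := by
  ext x; exact Triple.neg_one_pow_mul_self _

/-- Signs square to 1, so multiplying by one toggles the membership of `k` in `S`. Hence the monoid
generated by the signs consists of Walsh functions. -/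
lemma coordSign_mul_walsh (k : ℕ) (S : Finset ℕ) :
    ∃ S', coordSign k * walsh S = walsh S' := by
  by_cases h : k ∈ S
  · refine ⟨S.erase k, ?_⟩
    conv_lhs => rw [← Finset.insert_erase h, walsh_insert (Finset.notMem_erase k S)]
    rw [← mul_assoc, coordSign_mul_self, one_mul]
  · exact ⟨insert k S, (walsh_insert h).symm⟩

lemma norm_walsh (S : Finset ℕ) (x : X) : ‖walsh S x‖ = 1 := by
  simp [walsh_apply, norm_prod]

lemma walsh_add_delta (S : Finset ℕ) (k : ℕ) (x : X) :
    walsh S (x + δ k) = (if k ∈ S then -1 else 1) * walsh S x := by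
  rw [walsh_apply, walsh_apply, Finset.prod_congr rfl fun j _ => Triple.sign_add_delta x j k,
    Finset.prod_mul_distrib, Finset.prod_ite_eq]

lemma star_coordSign (k : ℕ) : star (coordSign k) = coordSign k := by
  ext x; simp [coordSign_apply]

lemma separatesPoints_adjoin_coordSign :
    (Algebra.adjoin ℂ (Set.range coordSign)).SeparatesPoints := by
  intro x y hxy
  obtain ⟨k, hk⟩ := Function.ne_iff.1 hxy
  refine ⟨_, ⟨coordSign k, Algebra.subset_adjoin ⟨k, rfl⟩, rfl⟩, ?_⟩
  have h : ∀ a b : ZMod 2, a ≠ b → (a.val = 0 ∧ b.val = 1) ∨ (a.val = 1 ∧ b.val = 0) := by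
    decide
  simp only [coordSign_apply]
  rcases h _ _ hk with ⟨h1, h2⟩ | ⟨h1, h2⟩ <;> rw [h1, h2] <;> norm_num

lemma adjoin_coordSign_le_span_walsh :
    Subalgebra.toSubmodule (Algebra.adjoin ℂ (Set.range coordSign)) ≤
      Submodule.span ℂ (Set.range walsh) := by
  rw [Algebra.adjoin_eq_span]
  refine Submodule.span_mono fun φ hφ => ?_
  induction hφ using Submonoid.closure_induction_left with
  | one => exact ⟨∅, walsh_empty⟩
  | mul_left φ hφ ψ _ ih =>
    obtain ⟨k, rfl⟩ := hφ
    obtain ⟨S, rfl⟩ := ih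
    obtain ⟨S', h⟩ := coordSign_mul_walsh k S
    exact ⟨S', h.symm⟩

/-- The Walsh functions are total in `C(X)` (Stone-Weierstrass). -/
lemma dense_span_walsh : Dense (Submodule.span ℂ (Set.range walsh) : Set C(X, ℂ)) := by
  let A : StarSubalgebra ℂ C(X, ℂ) :=
    { Algebra.adjoin ℂ (Set.range coordSign) with
      star_mem' := by
        intro φ hφ
        have h : star φ ∈ star (Algebra.adjoin ℂ (Set.range coordSign)) := by
          rwa [Subalgebra.mem_star_iff, star_star]
        rw [Subalgebra.star_adjoin_comm] at h
        have h2 : star (Set.range coordSign) = Set.range coordSign := by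
          rw [← Set.image_star, ← Set.range_comp]
          exact congrArg Set.range (funext star_coordSign)
        rwa [h2] at h }
  have hA := ContinuousMap.starSubalgebra_topologicalClosure_eq_top_of_separatesPoints A
    separatesPoints_adjoin_coordSign
  have hd : Dense (A : Set C(X, ℂ)) := by
    rw [dense_iff_closure_eq, ← StarSubalgebra.topologicalClosure_coe, hA]
    rfl
  exact hd.mono adjoin_coordSign_le_span_walsh

/-! ### The operators on `L²` of Haar measure: sign multiplications and translations -/

section Haar

variable (μ : Measure X) [μ.IsAddHaarMeasure]

instance : (haarTriple μ).μ.IsAddHaarMeasure := ‹_›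

/-- The Walsh functions as elements of `L²(X, μ)`. -/
def walshLp (S : Finset ℕ) : (haarTriple μ).H :=
  ContinuousMap.toLp (E := ℂ) 2 (haarTriple μ).μ ℂ (walsh S)

lemma walshLp_coeFn (S : Finset ℕ) : walshLp μ S =ᵐ[(haarTriple μ).μ] walsh S :=
  ContinuousMap.coeFn_toLp _ _

/-- Continuous functions are dense in `L²`, and a continuous map of dense range carries dense sets
to dense sets. -/
lemma dense_span_walshLp :
    Dense (Submodule.span ℂ (Set.range (walshLp μ)) : Set (haarTriple μ).H) := by
  have h := (ContinuousMap.toLp_denseRange ℂ (haarTriple μ).μ (p := 2) ℂ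
    (by norm_num)).dense_image (ContinuousLinearMap.continuous _) dense_span_walsh
  refine h.mono ?_
  rintro _ ⟨φ, hφ, rfl⟩
  have := Submodule.mem_map_of_mem
    (f := (ContinuousMap.toLp (E := ℂ) 2 (haarTriple μ).μ ℂ).toLinearMap) hφ
  rw [Submodule.map_span, ← Set.range_comp] at this
  exact this

lemma walshLp_ne_zero (S : Finset ℕ) : walshLp μ S ≠ 0 := by
  intro h
  have h1 := walshLp_coeFn μ S
  rw [h] at h1
  have h2 : ∀ᵐ _ ∂(haarTriple μ).μ, False := by
    filter_upwards [h1, Lp.coeFn_zero ℂ 2 (haarTriple μ).μ] with x hx hx'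
    have := norm_walsh S x
    rw [← hx, hx'] at this
    simp at this
  obtain ⟨x, hx⟩ := h2.exists
  exact hx

/-- On the triple of a Haar measure, there is no Radon-Nikodym factor. -/
lemma twist_haar_coeFn (w : X → ℂ) (hw : Measurable w)
    (hw1 : ∀ᵐ x ∂(haarTriple μ).μ, ‖w x‖ = 1) (d : X) (hd : d ∈ Δ) (f : (haarTriple μ).H) :
    (haarTriple μ).twist w hw hw1 d hd f =ᵐ[(haarTriple μ).μ] fun x => w x * f (x + d) := by
  have h : ∀ᵐ x ∂(haarTriple μ).μ, (haarTriple μ).rn d x = 1 := by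
    unfold Triple.rn
    rw [translate_haar]
    exact Measure.rnDeriv_self _
  filter_upwards [(haarTriple μ).twist_coeFn w hw hw1 d hd f, h] with x hx hx'
  rw [hx, Triple.twistFun, hx']
  simp

/-- Multiplication by a Walsh function. -/
def walshMul (S : Finset ℕ) : (haarTriple μ).H →L[ℂ] (haarTriple μ).H :=
  (haarTriple μ).twist (walsh S) (walsh S).continuous.measurable
    (.of_forall (norm_walsh S)) 0 (zero_mem _)

/-- Translation by `δ k`. -/
def shift (k : ℕ) : (haarTriple μ).H →L[ℂ] (haarTriple μ).H :=
  (haarTriple μ).twist 1 measurable_one (by simp) (δ k) (delta_mem k)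

lemma walshMul_coeFn (S : Finset ℕ) (f : (haarTriple μ).H) :
    walshMul μ S f =ᵐ[(haarTriple μ).μ] fun x => walsh S x * f x := by
  simpa [walshMul] using twist_haar_coeFn μ (walsh S) (walsh S).continuous.measurable
    (.of_forall (norm_walsh S)) 0 (zero_mem _) f

lemma shift_coeFn (k : ℕ) (f : (haarTriple μ).H) :
    shift μ k f =ᵐ[(haarTriple μ).μ] fun x => f (x + δ k) := by
  simpa [shift] using twist_haar_coeFn μ 1 measurable_one (by simp) (δ k) (delta_mem k) f

lemma inner_shift_shift (k : ℕ) (f g : (haarTriple μ).H) :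
    inner ℂ (shift μ k f) (shift μ k g) = inner ℂ f g :=
  (LinearIsometry.mk (shift μ k).toLinearMap
    ((haarTriple μ).norm_twist _ _ _ _ _)).inner_map_map f g

lemma walshMul_injective (S : Finset ℕ) : Function.Injective (walshMul μ S) :=
  (LinearIsometry.mk (walshMul μ S).toLinearMap
    ((haarTriple μ).norm_twist _ _ _ _ _)).injective

lemma walshMul_empty (f : (haarTriple μ).H) : walshMul μ ∅ f = f := by
  apply Lp.ext
  filter_upwards [walshMul_coeFn μ ∅ f] with x hx
  simp [hx, walsh_empty]

lemma walshMul_insert {k : ℕ} {S : Finset ℕ} (h : k ∉ S) (f : (haarTriple μ).H) :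
    walshMul μ (insert k S) f = walshMul μ {k} (walshMul μ S f) := by
  apply Lp.ext
  filter_upwards [walshMul_coeFn μ (insert k S) f, walshMul_coeFn μ S f,
    walshMul_coeFn μ {k} (walshMul μ S f)] with x h1 h2 h3
  rw [h1, h3, h2, walsh_insert h]
  simp [walsh, mul_assoc]

lemma walshMul_one (S : Finset ℕ) : walshMul μ S (walshLp μ ∅) = walshLp μ S := by
  apply Lp.ext
  filter_upwards [walshMul_coeFn μ S (walshLp μ ∅), walshLp_coeFn μ ∅,
    walshLp_coeFn μ S] with x h1 h2 h3
  rw [h1, h2, h3, walsh_empty]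
  simp

/-- Characters diagonalize translations; the eigenvalues tell the Walsh functions apart. -/
lemma shift_walshLp (k : ℕ) (S : Finset ℕ) :
    shift μ k (walshLp μ S) = (if k ∈ S then -1 else 1 : ℂ) • walshLp μ S := by
  apply Lp.ext
  filter_upwards [shift_coeFn μ k (walshLp μ S), walshLp_coeFn μ S,
    ((haarTriple μ).quasi (delta_mem k)).ae (walshLp_coeFn μ S),
    Lp.coeFn_smul (if k ∈ S then -1 else 1 : ℂ) (walshLp μ S)] with x h1 h2 h3 h4
  rw [h1, h3, h4, Pi.smul_apply, h2, walsh_add_delta, smul_eq_mul]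

lemma opZ_haar (k : ℕ) (f : (haarTriple μ).H) :
    (haarTriple μ).opZ k f = -I • walshMul μ (Finset.range k) (shift μ k f) := by
  apply Lp.ext
  filter_upwards [twist_haar_coeFn μ _ ((haarTriple μ).measurable_weightZ k)
    ((haarTriple μ).norm_weightZ k) (δ k) (delta_mem k) f,
    walshMul_coeFn μ (Finset.range k) (shift μ k f), shift_coeFn μ k f,
    Lp.coeFn_smul (-I) (walshMul μ (Finset.range k) (shift μ k f))] with x h1 h2 h3 h4
  rw [Triple.opZ, h1, h4, Pi.smul_apply, h2, h3, walsh_range_apply, Triple.weightZ, pow_succ,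
    smul_eq_mul]
  simp only [haarTriple]
  ring

lemma opσ_haar (k : ℕ) (f : (haarTriple μ).H) :
    (haarTriple μ).opσ k f = I • walshMul μ {k} ((haarTriple μ).opZ k f) := by
  apply Lp.ext
  filter_upwards [(haarTriple μ).opσ_apply k f,
    walshMul_coeFn μ {k} ((haarTriple μ).opZ k f),
    Lp.coeFn_smul I (walshMul μ {k} ((haarTriple μ).opZ k f))] with x h1 h2 h3
  rw [h1, h3, Pi.smul_apply, h2]
  simp only [walsh, Finset.prod_singleton, coordSign_apply, smul_eq_mul]
  ring

/-- The translations in the two factors cancel, leaving a pure multiplication. This is how the sign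
multiplications are recovered from the representation. -/
lemma opσ_opZ_haar (k : ℕ) (f : (haarTriple μ).H) :
    (haarTriple μ).opσ k ((haarTriple μ).opZ k f) = -I • walshMul μ {k} f := by
  have h : (haarTriple μ).opZ k ((haarTriple μ).opZ k f) = -f :=
    congrArg (fun A : (haarTriple μ).H →L[ℂ] (haarTriple μ).H => A f)
      ((haarTriple μ).op_mul_self (Sum.inl k))
  rw [opσ_haar, h, map_neg, smul_neg, neg_smul]

end Haar

/-- An isometry `J` with `J² = -1` that preserves a subspace commutes with the projection. -/
lemma starProjection_comm {E : Type*} [NormedAddCommGroup E] [InnerProductSpace ℝ E]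
    (U : Submodule ℝ E) [U.HasOrthogonalProjection] (J : E →ₗ[ℝ] E) (hn : ∀ f, ‖J f‖ = ‖f‖)
    (hs : ∀ f, J (J f) = -f) (hU : ∀ f ∈ U, J f ∈ U) (f : E) :
    U.starProjection (J f) = J (U.starProjection f) := by
  refine Submodule.eq_starProjection_of_mem_orthogonal
    (hU _ (U.starProjection_apply_mem f)) ?_
  rw [← map_sub, Submodule.mem_orthogonal]
  intro u hu
  -- An isometry with square `-1` is skew-adjoint, so it preserves the orthogonal complement of `U`
  -- along with `U`.
  have h : inner ℝ (J (J u)) (J (f - U.starProjection f)) =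
      inner ℝ (J u) (f - U.starProjection f) := (LinearIsometry.mk J hn).inner_map_map _ _
  rw [hs, inner_neg_left, (Submodule.mem_orthogonal _ _).1
    (U.sub_starProjection_mem_orthogonal f) _ (hU u hu), neg_eq_zero] at h
  exact h

/-! ### Linear and antilinear operators commuting with the representation -/

section Semilinear

variable {μ : Measure X} [μ.IsAddHaarMeasure]
  {D : (haarTriple μ).H →L[ℝ] (haarTriple μ).H} {s : ℝ}

lemma real_smul_eq (r : ℝ) (f : (haarTriple μ).H) : r • f = (r : ℂ) • f := by
  rw [← one_smul ℂ f, ← smul_assoc, ← smul_assoc]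
  simp

lemma map_walshMul_singleton (hs : s * s = 1) (hI : ∀ f, D (I • f) = s • I • D f)
    (hZ : ∀ k f, D ((haarTriple μ).opZ k f) = (haarTriple μ).opZ k (D f))
    (hσ : ∀ k f, D ((haarTriple μ).opσ k f) = (haarTriple μ).opσ k (D f))
    (k : ℕ) (f : (haarTriple μ).H) :
    D (walshMul μ {k} f) = s • walshMul μ {k} (D f) := by
  have h := hσ k ((haarTriple μ).opZ k f)
  rw [hZ, opσ_opZ_haar, opσ_opZ_haar, neg_smul, map_neg, hI, neg_smul, neg_inj] at h
  -- At this point `s • I • D (M_k f) = I • M_k (D f)`; the factor `s • (-I)` inverts the left-hand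
  -- scalars, as `s * s = 1`.
  have h2 := congrArg (fun v => s • (-I) • v) h
  simp only [smul_comm (-I) s, smul_smul (-I) I, smul_smul s s, hs, neg_mul, I_mul_I, neg_neg,
    one_smul] at h2
  exact h2

lemma map_walshMul (hs : s * s = 1) (hI : ∀ f, D (I • f) = s • I • D f)
    (hZ : ∀ k f, D ((haarTriple μ).opZ k f) = (haarTriple μ).opZ k (D f))
    (hσ : ∀ k f, D ((haarTriple μ).opσ k f) = (haarTriple μ).opσ k (D f))
    (S : Finset ℕ) (f : (haarTriple μ).H) :
    D (walshMul μ S f) = s ^ S.card • walshMul μ S (D f) := by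
  induction S using Finset.induction_on with
  | empty => simp [walshMul_empty]
  | insert k S hk ih =>
    rw [walshMul_insert μ hk, map_walshMul_singleton hs hI hZ hσ, ih,
      ContinuousLinearMap.map_smul_of_tower, smul_smul, walshMul_insert μ hk,
      Finset.card_insert_of_notMem hk, pow_succ']

/-- Apply `opZ k` to the constant function, which the translation fixes. Moving `D` past the scalar
`-I` costs one factor `s`, and past the `k` signs of `Finset.range k` another `k`. -/
lemma shift_map_one (hs : s * s = 1) (hI : ∀ f, D (I • f) = s • I • D f)
    (hZ : ∀ k f, D ((haarTriple μ).opZ k f) = (haarTriple μ).opZ k (D f))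
    (hσ : ∀ k f, D ((haarTriple μ).opσ k f) = (haarTriple μ).opσ k (D f)) (k : ℕ) :
    shift μ k (D (walshLp μ ∅)) = s ^ (k + 1) • D (walshLp μ ∅) := by
  have h := hZ k (walshLp μ ∅)
  have h1 : shift μ k (walshLp μ ∅) = walshLp μ ∅ := by simp [shift_walshLp]
  rw [opZ_haar, opZ_haar, h1, neg_smul, map_neg, hI, map_walshMul hs hI hZ hσ, neg_smul,
    neg_inj, smul_comm s I] at h
  have h2 := smul_right_injective _ I_ne_zero h
  apply walshMul_injective μ (Finset.range k)
  rw [← h2, Finset.card_range, smul_smul, ContinuousLinearMap.map_smul_of_tower, pow_succ']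

/-- The translation is unitary and multiplies the inner product by the product of the two
eigenvalues, here `-1`. -/
lemma inner_walshLp_eq_zero {g : (haarTriple μ).H} {r : ℝ} {k : ℕ} {S : Finset ℕ}
    (hg : shift μ k g = r • g) (hr : (if k ∈ S then -1 else 1) * r = -1) :
    inner ℂ (walshLp μ S) g = 0 := by
  have h := inner_shift_shift μ k (walshLp μ S) g
  rw [hg, shift_walshLp, real_smul_eq, inner_smul_left, inner_smul_right, ← mul_assoc] at h
  have h2 : (starRingEnd ℂ) (if k ∈ S then -1 else 1 : ℂ) * (r : ℂ) = -1 := by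
    have := congrArg (fun t : ℝ => (t : ℂ)) hr
    split_ifs at this ⊢ <;> simpa using this
  rw [h2] at h
  linear_combination (-1 / 2 : ℂ) * h

lemma eq_zero_of_inner_walshLp {g : (haarTriple μ).H}
    (h : ∀ S, inner ℂ (walshLp μ S) g = 0) : g = 0 := by
  suffices H : ∀ v ∈ Submodule.span ℂ (Set.range (walshLp μ)), inner ℂ g v = 0 from
    (dense_span_walshLp μ).eq_zero_of_inner_left (𝕜 := ℂ) H
  intro v hv
  induction hv using Submodule.span_induction with
  | mem x hx =>
    obtain ⟨S, rfl⟩ := hx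
    rw [← inner_conj_symm, h, map_zero]
  | zero => exact inner_zero_right _
  | add x y _ _ hx hy => rw [inner_add_right, hx, hy, add_zero]
  | smul a x _ hx => rw [inner_smul_right, hx, mul_zero]

/-- `D` is only real-linear, but `hI` makes its kernel stable under `I`, so the kernel contains the
complex span of the Walsh functions. -/
lemma eq_zero_of_map_walshLp (hI : ∀ f, D (I • f) = s • I • D f)
    (h : ∀ S, D (walshLp μ S) = 0) : D = 0 := by
  refine ContinuousLinearMap.ext fun f => ?_
  refine congrFun (Continuous.ext_on (dense_span_walshLp μ) D.continuous
    (continuous_zero) fun f hf => ?_) f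
  change D f = 0
  induction hf using Submodule.span_induction with
  | mem x hx => obtain ⟨S, rfl⟩ := hx; exact h S
  | zero => exact map_zero D
  | add x y _ _ hx hy => rw [map_add, hx, hy, add_zero]
  | smul a x _ hx =>
    have ha : a • x = a.re • x + a.im • I • x := by
      conv_lhs => rw [← re_add_im a, add_smul, mul_smul, ← real_smul_eq, ← real_smul_eq]
    rw [ha, map_add, map_smul, map_smul, hI, hx]
    simp

/-- A bounded complex-linear operator that commutes with the representation is a scalar. -/
lemma exists_eq_smul (hI : ∀ f, D (I • f) = I • D f)
    (hZ : ∀ k f, D ((haarTriple μ).opZ k f) = (haarTriple μ).opZ k (D f))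
    (hσ : ∀ k f, D ((haarTriple μ).opσ k f) = (haarTriple μ).opσ k (D f)) :
    ∃ c : ℂ, ∀ f, D f = c • f := by
  have hI' : ∀ f, D (I • f) = (1 : ℝ) • I • D f := by simpa using hI
  set e := walshLp μ ∅ with he
  have hsh := shift_map_one (one_mul 1) hI' hZ hσ
  have hshe : ∀ k, shift μ k e = (1 : ℝ) • e := by simp [he, shift_walshLp]
  have hee : inner ℂ e e ≠ 0 := inner_self_ne_zero.2 (walshLp_ne_zero μ ∅)
  -- The coefficient of the orthogonal projection of `D e` onto the line of constants.
  set c : ℂ := inner ℂ e (D e) / inner ℂ e e with hc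
  have hDe : D e = c • e := by
    refine sub_eq_zero.1 (eq_zero_of_inner_walshLp fun S => ?_)
    rw [inner_sub_right, inner_smul_right]
    rcases S.eq_empty_or_nonempty with rfl | ⟨k, hk⟩
    · rw [hc, div_mul_cancel₀ _ hee, sub_self]
    -- Translation by `δ k` with `k ∈ S` negates the Walsh function but fixes both `D e` and `e`.
    · rw [inner_walshLp_eq_zero (hsh k) (by simp [hk]),
        inner_walshLp_eq_zero (hshe k) (by simp [hk])]
      simp
  let R : (haarTriple μ).H →L[ℝ] (haarTriple μ).H :=
    (c • ContinuousLinearMap.id ℂ (haarTriple μ).H).restrictScalars ℝ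
  have hR : ∀ f, R f = c • f := fun f => rfl
  have h0 : D - R = 0 := by
    refine eq_zero_of_map_walshLp (s := 1) (fun f => ?_) fun S => ?_
    · rw [sub_apply, sub_apply, hI, hR, hR, smul_comm c I, ← smul_sub, one_smul]
    · rw [sub_apply, hR, ← walshMul_one, map_walshMul (one_mul 1) hI' hZ hσ, ← he,
        hDe, one_pow, one_smul, map_smul, sub_self]
  exact ⟨c, fun f => by rw [sub_eq_zero.1 h0, hR]⟩

/-- A bounded antilinear operator that commutes with the representation is zero. -/
lemma eq_zero_of_antilinear (hI : ∀ f, D (I • f) = -(I • D f))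
    (hZ : ∀ k f, D ((haarTriple μ).opZ k f) = (haarTriple μ).opZ k (D f))
    (hσ : ∀ k f, D ((haarTriple μ).opσ k f) = (haarTriple μ).opσ k (D f)) : D = 0 := by
  have hI' : ∀ f, D (I • f) = (-1 : ℝ) • I • D f := by simpa using hI
  have hs : (-1 : ℝ) * -1 = 1 := by norm_num
  have hDe : D (walshLp μ ∅) = 0 := by
    refine eq_zero_of_inner_walshLp fun S => ?_
    -- At an even index `2 * n` the eigenvalue on `D e` is `(-1) ^ (2 * n + 1) = -1`, while the
    -- Walsh function of `S` is fixed when `2 * n ∉ S`. Such an index exists because `S` is finite.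
    obtain ⟨n, hn⟩ : ∃ n, 2 * n ∉ S := by
      obtain ⟨m, hm⟩ := S.bddAbove
      refine ⟨m + 1, fun h => ?_⟩
      have := hm h
      omega
    refine inner_walshLp_eq_zero (shift_map_one hs hI' hZ hσ (2 * n)) ?_
    rw [if_neg hn, pow_succ, pow_mul]
    norm_num
  refine eq_zero_of_map_walshLp hI' fun S => ?_
  rw [← walshMul_one, map_walshMul hs hI' hZ hσ, hDe, map_zero, smul_zero]

end Semilinear

/-! ### Irreducibility -/

lemma irreducibleOver_real {Z : Type*} [NormedAddCommGroup Z] [InnerProductSpace ℂ Z]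
    (b : HilbertBasis ℕ ℂ Z) (μ : Measure X) [μ.IsAddHaarMeasure] :
    IrreducibleOver ℝ ((haarTriple μ).rep b) := by
  refine ⟨⟨_, _, walshLp_ne_zero μ ∅⟩, fun U hU hinv => ?_⟩
  have hrep : ∀ z, (haarTriple μ).rep b (CliffordAlgebra.ι _ z) = (haarTriple μ).J b z :=
    fun z => CliffordAlgebra.lift_ι_apply _ _ _
  have hop : ∀ i, ∀ f ∈ U, (haarTriple μ).op i f ∈ U := by
    rintro (k | k) f hf
    · have h := hinv (CliffordAlgebra.ι _ (b k)) f hf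
      have e := congrArg (fun A : (haarTriple μ).H →L[ℂ] (haarTriple μ).H => A f)
        ((hrep (b k)).trans ((haarTriple μ).J_basis b k))
      exact (congrArg (· ∈ U) e).mp h
    · have h := hinv (CliffordAlgebra.ι _ (I • b k)) f hf
      have e := congrArg (fun A : (haarTriple μ).H →L[ℂ] (haarTriple μ).H => A f)
        ((hrep (I • b k)).trans ((haarTriple μ).J_I_smul_basis b k))
      exact (congrArg (· ∈ U) e).mp h
  have : CompleteSpace U := hU.completeSpace_coe
  set P := U.starProjection with hP
  have hcomm : ∀ i f, P ((haarTriple μ).op i f) = (haarTriple μ).op i (P f) := fun i f =>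
    starProjection_comm U ((haarTriple μ).op i |>.toLinearMap.restrictScalars ℝ)
      ((haarTriple μ).norm_op i)
      (fun f => congrArg (fun A : (haarTriple μ).H →L[ℂ] (haarTriple μ).H => A f)
        ((haarTriple μ).op_mul_self i)) (hop i) f
  let R : (haarTriple μ).H →L[ℝ] (haarTriple μ).H :=
    (I • ContinuousLinearMap.id ℂ (haarTriple μ).H).restrictScalars ℝ
  -- `f ↦ I • P (I • f)` is `-P` on the complex-linear part of `P` and `P` on the antilinear part,
  -- so `P + Q` is twice the antilinear part. It still commutes with the operators, which are
  -- complex-linear.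
  let Q : (haarTriple μ).H →L[ℝ] (haarTriple μ).H := R ∘L P ∘L R
  have hQ : ∀ f, Q f = I • P (I • f) := fun f => rfl
  have hII : ∀ f : (haarTriple μ).H, I • I • f = -f := fun f => by
    rw [smul_smul, I_mul_I, neg_one_smul]
  have hQcomm : ∀ i f, Q ((haarTriple μ).op i f) = (haarTriple μ).op i (Q f) := fun i f => by
    rw [hQ, hQ, ← ContinuousLinearMap.map_smul, hcomm, ContinuousLinearMap.map_smul]
  have hanti : P + Q = 0 := by
    refine eq_zero_of_antilinear (fun f => ?_) (fun k f => ?_) fun k f => ?_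
    · rw [add_apply, add_apply, hQ, hQ, hII, map_neg, smul_add, hII, smul_neg]
      abel
    · exact (congrArg₂ (· + ·) (hcomm (.inl k) f) (hQcomm (.inl k) f)).trans (map_add _ _ _).symm
    · exact (congrArg₂ (· + ·) (hcomm (.inr k) f) (hQcomm (.inr k) f)).trans (map_add _ _ _).symm
  have hPI : ∀ f, P (I • f) = I • P f := fun f => by
    have h : P (I • f) + Q (I • f) = 0 := congrArg (fun A => A (I • f)) hanti
    rw [hQ, hII, map_neg, smul_neg, add_neg_eq_zero] at h
    exact h
  obtain ⟨c, hc⟩ := exists_eq_smul hPI (fun k => hcomm (.inl k)) (fun k => hcomm (.inr k))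
  by_cases h : c = 0
  · left
    rw [Submodule.eq_bot_iff]
    intro f hf
    rw [← Submodule.starProjection_eq_self_iff.2 hf, ← hP, hc, h, zero_smul]
  · right
    rw [Submodule.eq_top_iff']
    intro f
    -- A nonzero scalar is surjective, so the range of `P`, which lies in `U`, is everything.
    have h1 : P (c⁻¹ • f) = f := by rw [hc, smul_inv_smul₀ h]
    rw [← h1]
    exact U.starProjection_apply_mem _

end GW

end

theorem corollary3p8 {Z : Type*} [NormedAddCommGroup Z] [InnerProductSpace ℂ Z]
    (b : HilbertBasis ℕ ℂ Z) (μ : MeasureTheory.Measure GW.X) [μ.IsAddHaarMeasure] :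
    GW.IrreducibleOver ℂ ((GW.haarTriple μ).rep b) ∧
      GW.IrreducibleOver ℝ ((GW.haarTriple μ).rep b) := by
  have h := GW.irreducibleOver_real b μ
  refine ⟨⟨h.1, fun U hU hinv => ?_⟩, h⟩
  rcases h.2 (U.restrictScalars ℝ) hU hinv with h0 | h0
  · exact .inl ((Submodule.restrictScalars_eq_bot_iff ℝ _ _).1 h0)
  · exact .inr ((Submodule.restrictScalars_eq_top_iff ℝ _ _).1 h0)
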